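/- Let $f:\mathbb R^n\to\mathbb R$ be twice continuously differentiable, let $\varphi:\mathbb R^n\to(-\infty,\infty]$ be proper and lower semicontinuous, and let $\tau>0$. Let $\bar x$ satisfy $0\in\partial(f+\varphi)(\bar x)$, where $\partial$ is the limiting subdifferential, and put $\bar v=-\nabla f(\bar x)$ and $\bar z=\bar x+\tau\bar v$. Assume: (A.1) $\varphi$ is globally prox-regular at $\bar x$ for $\bar v$ with a constant $\rho$ such that $\tau\rho<1$. That is, $\bar v\in\partial\varphi(\bar x)$, $\varphi$ is locally lower semicontinuous at $\bar x$, and there is $\epsilon>0$ such that $\varphi(x')\ge\varphi(x)+\langle v,x'-x\rangle-\frac\rho2\|x'-x\|^2$ for all $x'\in\mathbb R^n$ whenever $\|x-\bar x\|<\epsilon$, $\|v-\bar v\|<\epsilon$, $v\in\partial\varphi(x)$ and $\varphi(x)<\varphi(\bar x)+\epsilon$. (A.2) $\varphi$ is twice epi-differentiable at $\bar x$ for $\bar v$, and its second subderivative satisfies $\mathrm d^2\varphi(\bar x|\bar v)(h)=\langle h,Qh\rangle+\iota_S(h)$ for all $h\in\mathbb R^n$, where $S\subseteq\mathbb R^n$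 is a closed convex cone, $Q\in\mathbb R^{n\times n}$ is symmetric with $\mathcal R(Q)\subseteq\operatorname{aff}(S)$, and $\iota_S$ is the indicator function of $S$ ($0$ on $S$, $+\infty$ elsewhere). Suppose further that for every sequence $(x^k,v^k)\to(\bar x,\bar v)$ with $v^k\in\partial\varphi(x^k)$ such that, for all $k$, $\varphi$ is twice epi-differentiable at $x^k$ for $v^k$ and $\mathrm d^2\varphi(x^k|v^k)$ is generalized quadratic (of the form $w\mapsto\langle w,A_kw\rangle+\iota_{L_k}(w)$ with $A_k$ symmetric and $L_k$ a linear subspace), one has $$\liminf_{k\to\infty,\ \tilde w\to w}\mathrm d^2\varphi(x^k|v^k)(\tilde w)\ \ge\ \langle w,Qw\rangle+\iota_{\operatorname{aff}(S)}(w)\qquad\text{for all } w\in\mathbb R^n .$$ Let $\operatorname{prox}_{\tau\varphi}(z)=\operatorname{argmin}_y\{\varphi(y)+\frac1{2\tau}\|z-y\|^2\}$, which is single-valued near $\bar z$. Let $\partial_B\operatorname{prox}_{\tau\varphi}(\bar z)$ be its Bouligand subdifferential, i.e. the set of all limits of $D\operatorname{prox}_{\tau\varphi}(z^k)$ along sequences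 $z^k\to\bar z$ of points of differentiability. Then for every $D\in\partial_B\operatorname{prox}_{\tau\varphi}(\bar z)$ there is a symmetric matrix $A\in\mathbb R^{n\times n}$ with $I+\tau A$ invertible such that $$D=\Pi_{\mathcal R(D)}(I+\tau A)^{-1}\Pi_{\mathcal R(D)},\qquad \mathcal R(A)\subseteq\mathcal R(D)\subseteq\operatorname{aff}(S),\qquad A\succeq\Pi_{\mathcal R(D)}Q\,\Pi_{\mathcal R(D)},$$ where $\mathcal R(\cdot)$ denotes the range and $\Pi_{\mathcal R(D)}$ the orthogonal projection onto $\mathcal R(D)$. -/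

import Mathlib

open Filter Topology
open scoped InnerProductSpace

namespace VarAnalysis

noncomputable section

/-- `φ` is proper: it never takes the value `-∞` and is not identically `+∞`. -/
def Proper {E : Type*} [NormedAddCommGroup E] [InnerProductSpace ℝ E]
    (φ : E → EReal) : Prop :=
  (∀ x, φ x ≠ ⊥) ∧ ∃ x, φ x ≠ ⊤

open Classical in
/-- The indicator function of a set in the sense of convex analysis: `0` on `C`, `+∞` off `C`. -/
def indicatorFn {E : Type*} [NormedAddCommGroup E] [InnerProductSpace ℝ E]
    (C : Set E) (w : E) : EReal :=
  if w ∈ C then 0 else ⊤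

/-- The regular (Fréchet) subdifferential; it is empty where `φ` is not finite. -/
def regularSubdiff {E : Type*} [NormedAddCommGroup E] [InnerProductSpace ℝ E]
    (φ : E → EReal) (x : E) : Set E :=
  {v | φ x ≠ ⊤ ∧ φ x ≠ ⊥ ∧ ∀ ε : ℝ, 0 < ε → ∀ᶠ y in 𝓝 x,
    φ x + ((⟪v, y - x⟫_ℝ - ε * ‖y - x‖ : ℝ) : EReal) ≤ φ y}

/-- The (limiting) subdifferential: the outer limit of the regular subdifferentials at `y`
as `y → x` with `φ y → φ x`. -/
def limitingSubdiff {E : Type*} [NormedAddCommGroup E] [InnerProductSpace ℝ E]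
    (φ : E → EReal) (x : E) : Set E :=
  {v | φ x ≠ ⊤ ∧ φ x ≠ ⊥ ∧ ∃ (y u : ℕ → E),
    Tendsto y atTop (𝓝 x) ∧ Tendsto (fun k => φ (y k)) atTop (𝓝 (φ x)) ∧
    Tendsto u atTop (𝓝 v) ∧ ∀ k, u k ∈ regularSubdiff φ (y k)}

/-- The second-order difference quotient of `φ` at `x` relative to `v`, with step `t`, in the
direction `h` (used for `φ x` finite and `t > 0`). -/
def secondQuotient {E : Type*} [NormedAddCommGroup E] [InnerProductSpace ℝ E]
    (φ : E → EReal) (x v : E) (t : ℝ) (h : E) : EReal :=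
  (φ (x + t • h) - φ x - ((t * ⟪v, h⟫_ℝ : ℝ) : EReal)) / ((t ^ 2 / 2 : ℝ) : EReal)

/-- The second subderivative: the lower limit of the second-order difference quotients as
`t ↓ 0` and `h' → h`. -/
def secondSubderiv {E : Type*} [NormedAddCommGroup E] [InnerProductSpace ℝ E]
    (φ : E → EReal) (x v h : E) : EReal :=
  liminf (fun p : ℝ × E => secondQuotient φ x v p.1 p.2) (𝓝[>] (0 : ℝ) ×ˢ 𝓝 h)

/-- Epi-convergence of a sequence of extended-real-valued functions. -/
def EpiConverges {E : Type*} [NormedAddCommGroup E] [InnerProductSpace ℝ E]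
    (θ : ℕ → E → EReal) (θlim : E → EReal) : Prop :=
  ∀ x : E,
    (∀ y : ℕ → E, Tendsto y atTop (𝓝 x) → θlim x ≤ liminf (fun k => θ k (y k)) atTop) ∧
    (∃ y : ℕ → E, Tendsto y atTop (𝓝 x) ∧ limsup (fun k => θ k (y k)) atTop ≤ θlim x)

/-- Twice epi-differentiability at `x` for `v`: the second-order difference quotients
epi-converge as `t ↓ 0`; the limit is then necessarily the second subderivative. -/
def TwiceEpiDifferentiable {E : Type*} [NormedAddCommGroup E] [InnerProductSpace ℝ E]
    (φ : E → EReal) (x v : E) : Prop :=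
  ∀ t : ℕ → ℝ, (∀ k, 0 < t k) → Tendsto t atTop (𝓝 0) →
    EpiConverges (fun k => secondQuotient φ x v (t k)) (secondSubderiv φ x v)

/-- The lower epi-limit of a sequence of functions at `w`: the lower limit of `θ k w'` as
`k → ∞` and `w' → w`. -/
def epiLiminf {E : Type*} [NormedAddCommGroup E] [InnerProductSpace ℝ E]
    (θ : ℕ → E → EReal) (w : E) : EReal :=
  liminf (fun p : ℕ × E => θ p.1 p.2) ((atTop : Filter ℕ) ×ˢ 𝓝 w)

/-- `θ` is generalized quadratic: a quadratic form plus the indicator of a linear subspace. -/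
def GeneralizedQuadratic {E : Type*} [NormedAddCommGroup E] [InnerProductSpace ℝ E]
    (θ : E → EReal) : Prop :=
  ∃ (L : Submodule ℝ E) (A : E →L[ℝ] E), A.IsSymmetric ∧
    ∀ w, θ w = ((⟪w, A w⟫_ℝ : ℝ) : EReal) + indicatorFn (L : Set E) w

/-- A closed convex cone (nonempty, so that it contains the origin). -/
def IsClosedConvexCone {E : Type*} [NormedAddCommGroup E] [InnerProductSpace ℝ E]
    (S : Set E) : Prop :=
  S.Nonempty ∧ IsClosed S ∧ Convex ℝ S ∧ ∀ c : ℝ, 0 < c → ∀ h ∈ S, c • h ∈ S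

/-- `θ` has generalized conic quadratic form with data `Q` and `S`. -/
structure GeneralizedConicQuadratic {E : Type*} [NormedAddCommGroup E] [InnerProductSpace ℝ E]
    (θ : E → EReal) (Q : E →L[ℝ] E)
    (S : Set E) : Prop where
  symm : Q.IsSymmetric
  cone : IsClosedConvexCone S
  range_subset : Set.range Q ⊆ (affineSpan ℝ S : Set E)
  eq : ∀ h, θ h = ((⟪h, Q h⟫_ℝ : ℝ) : EReal) + indicatorFn S h

/-- Local lower semicontinuity at `x`. -/
def LocallyLsc {E : Type*} [NormedAddCommGroup E] [InnerProductSpace ℝ E]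
    (φ : E → EReal) (x : E) : Prop :=
  ∃ ε : ℝ, 0 < ε ∧ ∀ α : ℝ, (α : EReal) ≤ φ x + (ε : EReal) →
    IsClosed {y | y ∈ Metric.closedBall x ε ∧ φ y ≤ (α : EReal)}

/-- Global prox-regularity of `φ` at `xbar` for the subgradient `vbar` with constant `ρ`. -/
def GloballyProxRegular {E : Type*} [NormedAddCommGroup E] [InnerProductSpace ℝ E]
    (φ : E → EReal) (xbar vbar : E) (ρ : ℝ) : Prop :=
  vbar ∈ limitingSubdiff φ xbar ∧ LocallyLsc φ xbar ∧
  ∃ ε : ℝ, 0 < ε ∧ ∀ x v : E, ‖x - xbar‖ < ε → ‖v - vbar‖ < ε →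
    v ∈ limitingSubdiff φ x → φ x < φ xbar + (ε : EReal) →
    ∀ x' : E, φ x + ((⟪v, x' - x⟫_ℝ - ρ / 2 * ‖x' - x‖ ^ 2 : ℝ) : EReal) ≤ φ x'

/-- The (set-valued) proximity operator of `φ` with parameter `τ`. -/
def prox {E : Type*} [NormedAddCommGroup E] [InnerProductSpace ℝ E]
    (φ : E → EReal) (τ : ℝ) (z : E) : Set E :=
  {y | ∀ y' : E, φ y + ((1 / (2 * τ) * ‖z - y‖ ^ 2 : ℝ) : EReal) ≤
    φ y' + ((1 / (2 * τ) * ‖z - y'‖ ^ 2 : ℝ) : EReal)}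

/-- The set-valued map `F` is single-valued near `z` and, as a function there, is differentiable
at `z` with derivative `D`. -/
def HasSingleValuedFDerivAt {E : Type*} [NormedAddCommGroup E] [InnerProductSpace ℝ E]
    (F : E → Set E) (D : E →L[ℝ] E)
    (z : E) : Prop :=
  ∃ p : E → E, (∀ᶠ y in 𝓝 z, F y = {p y}) ∧ HasFDerivAt p D z

/-- The Bouligand subdifferential at `z` of a map that is single-valued near `z`: all limits of
derivatives at points of differentiability converging to `z`. -/
def bouligandSubdiff {E : Type*} [NormedAddCommGroup E] [InnerProductSpace ℝ E]
    (F : E → Set E) (z : E) :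
    Set (E →L[ℝ] E) :=
  {D | ∃ (y : ℕ → E) (L : ℕ → (E →L[ℝ] E)), Tendsto y atTop (𝓝 z) ∧
    (∀ k, HasSingleValuedFDerivAt F (L k) (y k)) ∧ Tendsto L atTop (𝓝 D)}

/-- The orthogonal projection onto the range of `D`, as an endomorphism of the space. -/
def rangeProj {E : Type*} [NormedAddCommGroup E] [InnerProductSpace ℝ E]
    [FiniteDimensional ℝ E] (D : E →L[ℝ] E) : E →L[ℝ] E :=
  (LinearMap.range (D : E →ₗ[ℝ] E)).starProjection

/-- The structural condition on a single generalized derivative `D`: there is a symmetric `A`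
with `I + τA` invertible, `D = Π (I + τA)⁻¹ Π`, `range A ⊆ range D ⊆ aff S` and `A ⪰ Π Q Π`,
where `Π` is the orthogonal projection onto the range of `D`. -/
def HasProxStructure {E : Type*} [NormedAddCommGroup E] [InnerProductSpace ℝ E]
    [FiniteDimensional ℝ E] (τ : ℝ) (Q : E →L[ℝ] E) (S : Set E)
    (D : E →L[ℝ] E) : Prop :=
  ∃ A : E →L[ℝ] E, A.IsSymmetric ∧
    IsUnit (1 + τ • A) ∧
    D = rangeProj D * Ring.inverse (1 + τ • A) * rangeProj D ∧
    Set.range A ⊆ Set.range D ∧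
    Set.range D ⊆ (affineSpan ℝ S : Set E) ∧
    (A - rangeProj D * Q * rangeProj D).IsPositive

/-- The Euclidean space of dimension `n`. -/
abbrev Euc (n : ℕ) : Type := EuclideanSpace ℝ (Fin n)

end

end VarAnalysis

open VarAnalysis

/-!
Write `P` for the proximity operator `prox φ τ` and `e` for the Moreau envelope. The argument goes
through the points `z` near `zbar` at which `P` is differentiable, with derivative `D`.

Prox-regularity turns the proximal points near `zbar` into a Lipschitz single-valued map
(`exists_ball_prox_lipschitz`), so that `e` is differentiable near `z` with gradient `(z - P z) / τ`
(`hasFDerivAt_envelopeAlong`). Consequently `D` is symmetric, being `1 - τ ∇²e(z)`, and `e` has a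
second-order expansion at `z`.

Put `x = P z` and `v = (z - x) / τ`. The second-order difference quotients of `e` at `z` are Moreau
envelopes of those of `φ` at `x` for `v`: for every direction `h`,
`Δ²e(h) - ‖h - w‖² / τ ≤ Δ²φ(w)`, with equality at `w = (P (z + t h) - x) / t → D h`. The equality
case yields recovery sequences, and the inequality with a well-chosen fixed `h` yields the lower
bounds. Hence `φ` is twice epi-differentiable at `x` for `v`, with
`d²φ(x|v)(D h) = (⟪h, D h⟫ - ‖D h‖²) / τ` and `d²φ(x|v) = ⊤` off `range D`
(`secondSubderiv_apply`, `secondSubderiv_eq_top`). This function is generalized quadratic, with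
operator `A = τ⁻¹ (D⁻¹ - 1)` on `range D` (`exists_symmetric_pseudoinverse`).

Now let such derivatives `L k`, at points tending to `zbar`, converge to `D`. Testing the assumed
lower bound for the lower epi-limit along `L k h → D h` gives
`⟪D h, Q (D h)⟫ + ι_{aff S}(D h) ≤ (⟪h, D h⟫ - ‖D h‖²) / τ`. The right-hand side is finite, so
`range D ⊆ aff S`, and the inequality of quadratic forms on `range D` is the asserted bound for
`A = τ⁻¹ (D⁻¹ - 1)` (`hasProxStructure_of_le`).
-/

namespace VarAnalysis

/-! ### A pseudo-inverse of a symmetric operator -/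

section LinearAlgebra

variable {E : Type*} [NormedAddCommGroup E] [InnerProductSpace ℝ E] [FiniteDimensional ℝ E]

lemma rangeProj_apply_self (D : E →L[ℝ] E) (h : E) : rangeProj D (D h) = D h :=
  Submodule.starProjection_eq_self_iff.2 ⟨h, rfl⟩

lemma exists_eq_rangeProj (D : E →L[ℝ] E) (h : E) : ∃ g, D g = rangeProj D h := by
  obtain ⟨g, hg⟩ := Submodule.starProjection_apply_mem (LinearMap.range (D : E →ₗ[ℝ] E)) h
  exact ⟨g, hg⟩

lemma inner_rangeProj (D : E →L[ℝ] E) (u v : E) :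
    ⟪rangeProj D u, v⟫_ℝ = ⟪u, rangeProj D v⟫_ℝ :=
  Submodule.inner_starProjection_left_eq_right _ u v

lemma apply_rangeProj {D : E →L[ℝ] E} (hD : D.IsSymmetric) (h : E) : D (rangeProj D h) = D h := by
  refine ext_inner_right ℝ fun w => ?_
  have h1 : ∀ a b, ⟪D a, b⟫_ℝ = ⟪a, D b⟫_ℝ := fun a b => hD a b
  rw [h1, h1, inner_rangeProj, rangeProj_apply_self]

/-- For symmetric `D` with orthogonal range projection `Π`, the operator `B = D + 1 - Π` is
invertible, since `D` is injective on its range. The operator `A = τ⁻¹ (B⁻¹ - 1)` is the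
restriction of `τ⁻¹ (D⁻¹ - 1)` to `range D`, extended by `0` to the orthogonal complement. -/
lemma exists_symmetric_pseudoinverse {D : E →L[ℝ] E} (hD : D.IsSymmetric) {τ : ℝ} (hτ : 0 < τ) :
    ∃ A : E →L[ℝ] E, A.IsSymmetric ∧ IsUnit (1 + τ • A) ∧
      D = rangeProj D * Ring.inverse (1 + τ • A) * rangeProj D ∧
      Set.range A ⊆ Set.range D ∧
      ∀ h, ⟪D h, A (D h)⟫_ℝ = (⟪h, D h⟫_ℝ - ‖D h‖ ^ 2) / τ := by
  have hs : ∀ a b, ⟪D a, b⟫_ℝ = ⟪a, D b⟫_ℝ := fun a b => hD a b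
  set P := rangeProj D with hP
  have hPD : P * D = D := by ext1 h; exact rangeProj_apply_self D h
  have hDP : D * P = D := by ext1 h; exact apply_rangeProj hD h
  have hPP : P * P = P := by
    ext1 h
    obtain ⟨g, hg⟩ := exists_eq_rangeProj D h
    change P (P h) = P h
    rw [hP, ← hg, rangeProj_apply_self]
  set B : E →L[ℝ] E := D + (1 - P) with hB
  have hPB : P * B = D := by rw [hB, mul_add, mul_sub, hPD, hPP, mul_one, sub_self, add_zero]
  have hBP : B * P = D := by rw [hB, add_mul, sub_mul, hDP, hPP, one_mul, sub_self, add_zero]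
  have hBs : ∀ a b, ⟪B a, b⟫_ℝ = ⟪a, B b⟫_ℝ := fun a b => by
    simp [hB, inner_add_left, inner_add_right, inner_sub_left, inner_sub_right, hs, hP,
      inner_rangeProj]
  have hinj : Function.Injective B := by
    rw [injective_iff_map_eq_zero]
    intro u hu
    -- `D u = P (B u) = 0`, hence `u = P u` lies in `range D`, which is orthogonal to `ker D`.
    have h1 : D u = 0 := by rw [← hPB]; simp [hu]
    have h2 : u = P u := by
      have : B u = D u + (u - P u) := rfl
      rw [hu, h1, zero_add] at this
      exact sub_eq_zero.1 this.symm
    obtain ⟨g, hg⟩ := exists_eq_rangeProj D u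
    have : ⟪u, u⟫_ℝ = 0 := by
      nth_rewrite 1 [h2]
      rw [hP, ← hg, hs, h1, inner_zero_right]
    exact inner_self_eq_zero.1 this
  have hBu : IsUnit B := by
    rw [ContinuousLinearMap.isUnit_iff_bijective]
    exact ⟨hinj, (LinearMap.injective_iff_surjective (f := (B : E →ₗ[ℝ] E))).1 hinj⟩
  obtain ⟨C, hC⟩ := hBu
  set B' : E →L[ℝ] E := ((C⁻¹ : (E →L[ℝ] E)ˣ) : E →L[ℝ] E) with hB'
  have hl : B' * B = 1 := by rw [hB', ← hC]; simp
  have hr : B * B' = 1 := by rw [hB', ← hC]; simp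
  have hBs' : ∀ a b, ⟪B' a, b⟫_ℝ = ⟪a, B' b⟫_ℝ := fun a b => by
    have ha : a = B (B' a) := by change a = (B * B') a; rw [hr]; rfl
    have hb : b = B (B' b) := by change b = (B * B') b; rw [hr]; rfl
    nth_rewrite 2 [ha]
    rw [hBs, ← hb]
  have hsum : 1 + τ • (τ⁻¹ • (B' - 1)) = B' := by
    rw [smul_smul, mul_inv_cancel₀ hτ.ne', one_smul]; abel
  refine ⟨τ⁻¹ • (B' - 1), ?_, ?_, ?_, ?_, ?_⟩
  · intro a b
    change ⟪τ⁻¹ • (B' a - a), b⟫_ℝ = ⟪a, τ⁻¹ • (B' b - b)⟫_ℝ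
    simp [inner_smul_left, inner_smul_right, inner_sub_left, inner_sub_right, hBs']
  · rw [hsum]; exact ⟨C⁻¹, rfl⟩
  · rw [hsum, hB', Ring.inverse_unit, inv_inv, hC, hPB, hDP]
  · rintro _ ⟨u, rfl⟩
    -- `B⁻¹ - 1 = (1 - B) B⁻¹ = (P - D) B⁻¹`
    have h1 : B' - 1 = (P - D) * B' := by
      have : P - D = 1 - B := by rw [hB]; abel
      rw [this, sub_mul, hr, one_mul]
    obtain ⟨g, hg⟩ := exists_eq_rangeProj D (B' u)
    refine ⟨τ⁻¹ • (g - B' u), ?_⟩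
    rw [h1]
    change D (τ⁻¹ • (g - B' u)) = τ⁻¹ • (P (B' u) - D (B' u))
    rw [map_smul, map_sub, hg]
  · intro h
    have h1 : B' (D h) = P h := by
      rw [← hBP]
      change ((B' * B) * P) h = P h
      rw [hl]; rfl
    change ⟪D h, τ⁻¹ • (B' (D h) - D h)⟫_ℝ = _
    rw [h1, inner_smul_right, inner_sub_right, real_inner_self_eq_norm_sq, ← inner_rangeProj,
      rangeProj_apply_self, real_inner_comm]
    ring

end LinearAlgebra

/-! ### Proximal points near a prox-regular point -/

section Prox

variable {E : Type*} [NormedAddCommGroup E] [InnerProductSpace ℝ E] {φ : E → EReal} {τ : ℝ}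

lemma prox_finite (hφ : Proper φ) {y z : E} (hy : y ∈ prox φ τ z) :
    φ y = ((φ y).toReal : EReal) := by
  refine (EReal.coe_toReal ?_ (hφ.1 y)).symm
  intro htop
  obtain ⟨w, hw⟩ := hφ.2
  have h := hy w
  rw [htop, EReal.top_add_coe, ← EReal.coe_toReal hw (hφ.1 w), ← EReal.coe_add] at h
  exact absurd h (not_le.2 (EReal.coe_lt_top _))

lemma prox_le (hφ : Proper φ) {y z w : E} {r : ℝ} (hy : y ∈ prox φ τ z) (hw : φ w = r) :
    (φ y).toReal + 1 / (2 * τ) * ‖z - y‖ ^ 2 ≤ r + 1 / (2 * τ) * ‖z - w‖ ^ 2 := by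
  have h := hy w
  rw [prox_finite hφ hy, hw] at h
  exact_mod_cast h

/-- Fermat's rule for the proximal problem. -/
lemma prox_mem_limitingSubdiff (hφ : Proper φ) (hτ : 0 < τ) {y z : E} (hy : y ∈ prox φ τ z) :
    (1 / τ) • (z - y) ∈ limitingSubdiff φ y := by
  have hfin := prox_finite hφ hy
  have h1 : φ y ≠ ⊤ := by rw [hfin]; exact EReal.coe_ne_top _
  refine ⟨h1, hφ.1 y, fun _ => y, fun _ => (1 / τ) • (z - y), tendsto_const_nhds,
    tendsto_const_nhds, tendsto_const_nhds, fun _ => ⟨h1, hφ.1 y, fun ε hε => ?_⟩⟩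
  filter_upwards [Metric.ball_mem_nhds y (show 0 < 2 * τ * ε by positivity)] with w hw
  rcases eq_or_ne (φ w) ⊤ with htop | htop
  · rw [htop]; exact le_top
  have hwr := (EReal.coe_toReal htop (hφ.1 w)).symm
  have h2 := prox_le hφ hy hwr
  rw [hfin, hwr, ← EReal.coe_add, EReal.coe_le_coe_iff]
  have hd : ‖w - y‖ < 2 * τ * ε := by rwa [← dist_eq_norm]
  have h3 : ‖z - w‖ ^ 2 = ‖z - y‖ ^ 2 - 2 * ⟪z - y, w - y⟫_ℝ + ‖w - y‖ ^ 2 := by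
    rw [← norm_sub_sq_real]; congr 2; abel
  have h4 : 1 / (2 * τ) * ‖w - y‖ ^ 2 ≤ ε * ‖w - y‖ := by
    rw [div_mul_eq_mul_div, div_le_iff₀ (by positivity)]
    nlinarith [norm_nonneg (w - y)]
  have h5 : 1 / (2 * τ) * (2 * ⟪z - y, w - y⟫_ℝ) = 1 / τ * ⟪z - y, w - y⟫_ℝ := by
    field_simp
  rw [h3] at h2
  rw [real_inner_smul_left]
  nlinarith

variable {ρ : ℝ} {xbar vbar : E}

/-- Comparison of `y` with `xbar` in the proximal problem, together with the quadratic minorant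
of `φ` at `xbar`, gives a linear error bound for the proximal points. -/
lemma norm_prox_sub_le (hφ : Proper φ) (hτ : 0 < τ)
    (hreg : GloballyProxRegular φ xbar vbar ρ) {y z : E} (hy : y ∈ prox φ τ z) :
    (1 - τ * ρ) * ‖y - xbar‖ ≤ 2 * ‖z - (xbar + τ • vbar)‖ := by
  obtain ⟨hmem, -, ε, hε, hr⟩ := hreg
  have hc := (EReal.coe_toReal hmem.1 hmem.2.1).symm
  have h1 := hr xbar vbar (by simpa) (by simpa) hmem (by
    rw [hc, ← EReal.coe_add, EReal.coe_lt_coe_iff]; linarith) y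
  rw [hc, prox_finite hφ hy, ← EReal.coe_add, EReal.coe_le_coe_iff] at h1
  have h2 := prox_le hφ hy hc
  set d := y - xbar with hd
  set δ := z - (xbar + τ • vbar) with hδ
  have e1 : ‖z - y‖ ^ 2 = ‖z - xbar‖ ^ 2 - 2 * (τ * ⟪vbar, d⟫_ℝ + ⟪δ, d⟫_ℝ) + ‖d‖ ^ 2 := by
    have : z - y = (z - xbar) - d := by rw [hd]; abel
    rw [this, norm_sub_sq_real]
    have : z - xbar = τ • vbar + δ := by rw [hδ]; abel
    rw [this, inner_add_left, real_inner_smul_left]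
  have e2 := real_inner_le_norm δ d
  have e3 : 1 / (2 * τ) * ‖z - y‖ ^ 2 = 1 / (2 * τ) * ‖z - xbar‖ ^ 2 - ⟪vbar, d⟫_ℝ
      - 1 / τ * ⟪δ, d⟫_ℝ + 1 / (2 * τ) * ‖d‖ ^ 2 := by
    rw [e1]; field_simp; ring
  have e4 : (1 - τ * ρ) * ‖d‖ ^ 2 ≤ 2 * ⟪δ, d⟫_ℝ := by
    have h3 : 1 / (2 * τ) * ‖d‖ ^ 2 - ρ / 2 * ‖d‖ ^ 2 ≤ 1 / τ * ⟪δ, d⟫_ℝ := by linarith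
    have h4 := mul_le_mul_of_nonneg_left h3 (show 0 ≤ 2 * τ by positivity)
    have h5 : 2 * τ * (1 / τ * ⟪δ, d⟫_ℝ) = 2 * ⟪δ, d⟫_ℝ := by field_simp
    have h6 : 2 * τ * (1 / (2 * τ) * ‖d‖ ^ 2 - ρ / 2 * ‖d‖ ^ 2) = (1 - τ * ρ) * ‖d‖ ^ 2 := by
      field_simp
    linarith
  rcases (norm_nonneg d).eq_or_lt with h0 | h0
  · rw [← h0, mul_zero]; positivity
  · nlinarith

/-- Near `zbar = xbar + τ vbar`, the proximal points satisfy the prox-regularity inequality; in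
particular, the two inequalities at a pair of such points add up to a Lipschitz estimate. -/
lemma exists_ball_prox_lipschitz (hφ : Proper φ) (hτ : 0 < τ) (hτρ : τ * ρ < 1)
    (hreg : GloballyProxRegular φ xbar vbar ρ) :
    ∃ δ > 0, ∀ z₁ ∈ Metric.ball (xbar + τ • vbar) δ, ∀ z₂ ∈ Metric.ball (xbar + τ • vbar) δ,
      ∀ y₁ ∈ prox φ τ z₁, ∀ y₂ ∈ prox φ τ z₂, (1 - τ * ρ) * ‖y₁ - y₂‖ ≤ ‖z₁ - z₂‖ := by
  have hlin := fun {y z} (hy : y ∈ prox φ τ z) => norm_prox_sub_le hφ hτ hreg hy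
  obtain ⟨hmem, -, ε, hε, hr⟩ := hreg
  have hc := (EReal.coe_toReal hmem.1 hmem.2.1).symm
  set c := (φ xbar).toReal
  set zbar := xbar + τ • vbar with hz
  have hκ : 0 < 1 - τ * ρ := by linarith
  -- the subgradient inequality at proximal points of points close to `zbar`
  have key : ∀ᶠ z in 𝓝 zbar, ∀ y ∈ prox φ τ z, ∀ y' (r' : ℝ), φ y' = r' →
      (φ y).toReal + (⟪(1 / τ) • (z - y), y' - y⟫_ℝ - ρ / 2 * ‖y' - y‖ ^ 2) ≤ r' := by
    have t0 : Tendsto (fun z : E => ‖z - zbar‖) (𝓝 zbar) (𝓝 0) := by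
      have : Continuous fun z : E => ‖z - zbar‖ := by fun_prop
      simpa using this.tendsto zbar
    have t1 : Tendsto (fun z : E => 2 * ‖z - zbar‖ / (1 - τ * ρ)) (𝓝 zbar) (𝓝 0) := by
      simpa using (t0.const_mul 2).div_const (1 - τ * ρ)
    have t2 : Tendsto (fun z : E => 1 / τ * (‖z - zbar‖ + 2 * ‖z - zbar‖ / (1 - τ * ρ)))
        (𝓝 zbar) (𝓝 0) := by simpa using (t0.add t1).const_mul (1 / τ)
    have t3 : Tendsto (fun z : E => 1 / (2 * τ) * (2 * ‖z - xbar‖ *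
        (2 * ‖z - zbar‖ / (1 - τ * ρ)))) (𝓝 zbar) (𝓝 0) := by
      have : Tendsto (fun z : E => 2 * ‖z - xbar‖) (𝓝 zbar) (𝓝 (2 * ‖zbar - xbar‖)) :=
        Continuous.tendsto (by fun_prop) _
      simpa using (this.mul t1).const_mul (1 / (2 * τ))
    filter_upwards [t1.eventually_lt_const hε, t2.eventually_lt_const hε,
      t3.eventually_lt_const hε] with z h1 h2 h3 y hy y' r' hr'
    have hd : ‖y - xbar‖ ≤ 2 * ‖z - zbar‖ / (1 - τ * ρ) := by
      rw [le_div_iff₀ hκ, mul_comm]; exact hlin hy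
    have hv : ‖(1 / τ) • (z - y) - vbar‖ < ε := by
      have : (1 / τ) • (z - y) - vbar = (1 / τ) • ((z - zbar) - (y - xbar)) := by
        have h4 : vbar = (1 / τ) • (τ • vbar) := by
          rw [smul_smul, one_div_mul_cancel hτ.ne', one_smul]
        nth_rewrite 1 [h4]
        rw [← smul_sub, hz]; congr 1; abel
      rw [this, norm_smul, Real.norm_of_nonneg (by positivity)]
      refine lt_of_le_of_lt ?_ h2
      gcongr
      exact (norm_sub_le _ _).trans (by gcongr)
    have hval : φ y < φ xbar + (ε : EReal) := by
      rw [hc, prox_finite hφ hy, ← EReal.coe_add, EReal.coe_lt_coe_iff]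
      have h4 := prox_le hφ hy hc
      have h5 : ‖z - xbar‖ ^ 2 - ‖z - y‖ ^ 2 ≤ 2 * ‖z - xbar‖ * ‖y - xbar‖ := by
        have : z - y = (z - xbar) - (y - xbar) := by abel
        rw [this, norm_sub_sq_real (z - xbar) (y - xbar)]
        nlinarith [real_inner_le_norm (z - xbar) (y - xbar), sq_nonneg ‖y - xbar‖]
      have h6 : 1 / (2 * τ) * (‖z - xbar‖ ^ 2 - ‖z - y‖ ^ 2) ≤
          1 / (2 * τ) * (2 * ‖z - xbar‖ * (2 * ‖z - zbar‖ / (1 - τ * ρ))) := by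
        gcongr
        exact h5.trans (by gcongr)
      linarith
    have := hr y _ (hd.trans_lt h1) hv (prox_mem_limitingSubdiff hφ hτ hy) hval y'
    rw [prox_finite hφ hy, hr', ← EReal.coe_add, EReal.coe_le_coe_iff] at this
    exact this
  obtain ⟨δ, hδ, hball⟩ := Metric.eventually_nhds_iff_ball.1 key
  refine ⟨δ, hδ, fun z₁ hz₁ z₂ hz₂ y₁ hy₁ y₂ hy₂ => ?_⟩
  have h1 := hball z₁ hz₁ y₁ hy₁ y₂ _ (prox_finite hφ hy₂)
  have h2 := hball z₂ hz₂ y₂ hy₂ y₁ _ (prox_finite hφ hy₁)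
  set a := y₁ - y₂ with ha
  have h21 : y₂ - y₁ = -a := by rw [ha]; abel
  rw [h21, norm_neg, inner_neg_right] at h1
  have h3 : ⟪(1 / τ) • (z₂ - y₂), a⟫_ℝ - ⟪(1 / τ) • (z₁ - y₁), a⟫_ℝ
      = 1 / τ * (‖a‖ ^ 2 - ⟪z₁ - z₂, a⟫_ℝ) := by
    have : (z₂ - y₂) - (z₁ - y₁) = a - (z₁ - z₂) := by rw [ha]; abel
    rw [← inner_sub_left, ← smul_sub, real_inner_smul_left, this, inner_sub_left,
      real_inner_self_eq_norm_sq]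
  have h4 : 1 / τ * (‖a‖ ^ 2 - ⟪z₁ - z₂, a⟫_ℝ) ≤ ρ * ‖a‖ ^ 2 := by rw [← h3]; linarith
  rw [one_div, inv_mul_le_iff₀ hτ] at h4
  have h5 := real_inner_le_norm (z₁ - z₂) a
  rcases (norm_nonneg a).eq_or_lt with h0 | h0
  · rw [← h0, mul_zero]; positivity
  · nlinarith

end Prox

/-! ### The Moreau envelope near a point where the proximity operator is Lipschitz -/

section Envelope

variable {E : Type*} [NormedAddCommGroup E] [InnerProductSpace ℝ E]

/-- The Moreau envelope of `φ` written through a selection `p` of the proximity operator: the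
value of the proximal problem at `z`, as a real number, wherever `prox φ τ z = {p z}` and `φ` is
proper. -/
noncomputable def envelopeAlong (φ : E → EReal) (τ : ℝ) (p : E → E) (z : E) : ℝ :=
  (φ (p z)).toReal + 1 / (2 * τ) * ‖z - p z‖ ^ 2

variable {φ : E → EReal} {τ : ℝ} {p : E → E} {z : E}

lemma mem_prox_of_eq (h : prox φ τ z = {p z}) : p z ∈ prox φ τ z := by rw [h]; rfl

lemma envelopeAlong_le (hφ : Proper φ) (h : prox φ τ z = {p z}) {w : E} {r : ℝ} (hw : φ w = r) :
    envelopeAlong φ τ p z ≤ r + 1 / (2 * τ) * ‖z - w‖ ^ 2 :=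
  prox_le hφ (mem_prox_of_eq h) hw

/-- Upper quadratic model of the envelope: `z' ↦ φ (p z) + ‖z' - p z‖² / (2τ)` majorizes it and
agrees with it at `z`. -/
lemma envelopeAlong_sub_le (hφ : Proper φ) (hτ : 0 < τ) {z z' : E} (h : prox φ τ z = {p z})
    (h' : prox φ τ z' = {p z'}) :
    envelopeAlong φ τ p z' - envelopeAlong φ τ p z ≤
      ⟪(1 / τ) • (z - p z), z' - z⟫_ℝ + 1 / (2 * τ) * ‖z' - z‖ ^ 2 := by
  have h1 := envelopeAlong_le hφ h' (prox_finite hφ (mem_prox_of_eq h))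
  have h2 : ‖z' - p z‖ ^ 2 = ‖z - p z‖ ^ 2 + 2 * ⟪z - p z, z' - z⟫_ℝ + ‖z' - z‖ ^ 2 := by
    rw [← norm_add_sq_real]; congr 2; abel
  have h3 : 1 / (2 * τ) * (2 * ⟪z - p z, z' - z⟫_ℝ) = ⟪(1 / τ) • (z - p z), z' - z⟫_ℝ := by
    rw [real_inner_smul_left]; field_simp
  rw [h2] at h1
  rw [envelopeAlong.eq_1 φ τ p z]
  linarith

lemma hasFDerivAt_envelopeAlong (hφ : Proper φ) (hτ : 0 < τ)
    (hp : ∀ᶠ y in 𝓝 z, prox φ τ y = {p y}) {K : ℝ}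
    (hK : ∀ᶠ y in 𝓝 z, ‖p y - p z‖ ≤ K * ‖y - z‖) :
    HasFDerivAt (envelopeAlong φ τ p) (innerSL ℝ ((1 / τ) • (z - p z))) z := by
  have hO : (fun y => envelopeAlong φ τ p y - envelopeAlong φ τ p z
      - innerSL ℝ ((1 / τ) • (z - p z)) (y - z)) =O[𝓝 z] fun y => ‖y - z‖ ^ 2 := by
    refine Asymptotics.IsBigO.of_bound (1 / τ * (1 + |K|)) ?_
    filter_upwards [hp, hK] with y hy hKy
    have hz := hp.self_of_nhds
    have h1 := envelopeAlong_sub_le hφ hτ hz hy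
    have h2 := envelopeAlong_sub_le hφ hτ hy hz
    have h0 : 0 ≤ ‖y - z‖ := norm_nonneg _
    have h3 : ⟪(1 / τ) • (y - p y), z - y⟫_ℝ = -⟪(1 / τ) • (z - p z), y - z⟫_ℝ
        - 1 / τ * ‖y - z‖ ^ 2 + 1 / τ * ⟪p y - p z, y - z⟫_ℝ := by
      have e1 : y - p y = (z - p z) + (y - z) - (p y - p z) := by abel
      rw [e1, ← neg_sub y z, inner_neg_right, real_inner_smul_left, real_inner_smul_left,
        inner_sub_left _ (p y - p z), inner_add_left, real_inner_self_eq_norm_sq]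
      ring
    have h4 : ⟪p y - p z, y - z⟫_ℝ ≤ |K| * ‖y - z‖ ^ 2 := by
      calc ⟪p y - p z, y - z⟫_ℝ ≤ ‖p y - p z‖ * ‖y - z‖ := real_inner_le_norm _ _
        _ ≤ (|K| * ‖y - z‖) * ‖y - z‖ := by
          gcongr
          exact hKy.trans (by gcongr; exact le_abs_self K)
        _ = |K| * ‖y - z‖ ^ 2 := by ring
    have h5 : 1 / τ * ⟪p y - p z, y - z⟫_ℝ ≤ 1 / τ * (|K| * ‖y - z‖ ^ 2) := by gcongr
    have h6 : 1 / (2 * τ) * ‖y - z‖ ^ 2 = 1 / 2 * (1 / τ * ‖y - z‖ ^ 2) := by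
      field_simp
    have h7 : 0 ≤ 1 / τ * ‖y - z‖ ^ 2 := by positivity
    have h8 : 0 ≤ 1 / τ * (|K| * ‖y - z‖ ^ 2) := by positivity
    rw [norm_sub_rev z y, h3, h6] at h2
    rw [h6] at h1
    have h9 : 1 / τ * (1 + |K|) * ‖y - z‖ ^ 2
        = 1 / τ * ‖y - z‖ ^ 2 + 1 / τ * (|K| * ‖y - z‖ ^ 2) := by ring
    rw [Real.norm_eq_abs, Real.norm_eq_abs, abs_of_nonneg (sq_nonneg ‖y - z‖), innerSL_apply_apply,
      abs_le, h9]
    constructor <;> linarith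
  have h := hO.hasFDerivAt (𝕜 := ℝ) (by norm_num)
  have h2 := (h.add ((innerSL ℝ ((1 / τ) • (z - p z))).hasFDerivAt (x := z))).add_const
    (envelopeAlong φ τ p z - innerSL ℝ ((1 / τ) • (z - p z)) z)
  rw [zero_add] at h2
  refine h2.congr_of_eventuallyEq (Eventually.of_forall fun y => ?_)
  simp only [Pi.add_apply, map_sub]
  ring

/-- `p` represents the proximity operator near `z` and is Lipschitz there. -/
structure IsLipschitzProxSelection (φ : E → EReal) (τ : ℝ) (p : E → E) (z : E) : Prop where
  prox_eq : ∀ᶠ y in 𝓝 z, prox φ τ y = {p y}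
  lipschitz : ∃ K : ℝ, ∃ U ∈ 𝓝 z, ∀ y ∈ U, ∀ y' ∈ U, ‖p y - p y'‖ ≤ K * ‖y - y'‖

lemma IsLipschitzProxSelection.eventually_hasFDerivAt (hs : IsLipschitzProxSelection φ τ p z)
    (hφ : Proper φ) (hτ : 0 < τ) :
    ∀ᶠ y in 𝓝 z, HasFDerivAt (envelopeAlong φ τ p) (innerSL ℝ ((1 / τ) • (y - p y))) y := by
  obtain ⟨K, U, hU, hK⟩ := hs.lipschitz
  filter_upwards [hs.prox_eq.eventually_nhds, eventually_mem_nhds_iff.2 hU] with y hy hUy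
  refine hasFDerivAt_envelopeAlong hφ hτ hy (K := K) ?_
  filter_upwards [hUy] with y' hy'
  exact hK y' hy' y (mem_of_mem_nhds hUy)

variable {D : E →L[ℝ] E}

/-- The derivative of the proximity operator is symmetric because `(1 - D) / τ` is the second
derivative of the Moreau envelope. -/
lemma IsLipschitzProxSelection.isSymmetric (hs : IsLipschitzProxSelection φ τ p z)
    (hφ : Proper φ) (hτ : 0 < τ) (hD : HasFDerivAt p D z) : D.IsSymmetric := by
  have h1 : HasFDerivAt (fun y => (1 / τ) • (y - p y))
      ((1 / τ) • (ContinuousLinearMap.id ℝ E - D)) z :=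
    ((hasFDerivAt_id z).sub hD).const_smul (1 / τ)
  have h2 := (innerSL ℝ (E := E)).hasFDerivAt (x := (1 / τ) • (z - p z)) |>.comp z h1
  intro a b
  have h3 := second_derivative_symmetric_of_eventually (hs.eventually_hasFDerivAt hφ hτ) h2 a b
  change ⟪(1 / τ) • (a - D a), b⟫_ℝ = ⟪(1 / τ) • (b - D b), a⟫_ℝ at h3
  change ⟪D a, b⟫_ℝ = ⟪a, D b⟫_ℝ
  rw [real_inner_smul_left, real_inner_smul_left, inner_sub_left, inner_sub_left] at h3
  have h4 := mul_left_cancel₀ (one_div_pos.2 hτ).ne' h3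
  rw [real_inner_comm a b, real_inner_comm a (D b)] at h4
  linarith

/-- The second-order difference quotient of the Moreau envelope at `z`. -/
noncomputable def envelopeQuotient (φ : E → EReal) (τ : ℝ) (p : E → E) (z h : E) (t : ℝ) : ℝ :=
  (envelopeAlong φ τ p (z + t • h) - envelopeAlong φ τ p z
    - t * ⟪(1 / τ) • (z - p z), h⟫_ℝ) / (t ^ 2 / 2)

lemma tendsto_add_smul_nhdsGT (z h : E) : Tendsto (fun t : ℝ => z + t • h) (𝓝[>] 0) (𝓝 z) := by
  have : Continuous fun t : ℝ => z + t • h := by fun_prop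
  simpa using (this.tendsto 0).mono_left nhdsWithin_le_nhds

lemma tendsto_slope_nhdsGT (hD : HasFDerivAt p D z) (h : E) :
    Tendsto (fun t : ℝ => t⁻¹ • (p (z + t • h) - p z)) (𝓝[>] 0) (𝓝 (D h)) :=
  hD.hasLineDerivAt h |>.tendsto_slope_zero_right

lemma IsLipschitzProxSelection.tendsto_envelopeQuotient (hs : IsLipschitzProxSelection φ τ p z)
    (hφ : Proper φ) (hτ : 0 < τ) (hD : HasFDerivAt p D z) (h : E) :
    Tendsto (envelopeQuotient φ τ p z h) (𝓝[>] 0) (𝓝 ((‖h‖ ^ 2 - ⟪h, D h⟫_ℝ) / τ)) := by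
  have hev := hs.eventually_hasFDerivAt hφ hτ
  have hline : ∀ t : ℝ, HasDerivAt (fun t : ℝ => z + t • h) h t := fun t => by
    simpa using ((hasDerivAt_id t).smul_const h).const_add z
  set v := (1 / τ) • (z - p z) with hv
  refine HasDerivAt.lhopital_zero_nhdsGT
    (f' := fun t => ⟪(1 / τ) • (z + t • h - p (z + t • h)), h⟫_ℝ - ⟪v, h⟫_ℝ)
    (g' := fun t => t) ?_ ?_ ?_ ?_ ?_ ?_
  · filter_upwards [(tendsto_add_smul_nhdsGT z h).eventually hev] with t ht
    have h1 := ht.comp_hasDerivAt t (hline t)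
    have h2 := (h1.sub_const (envelopeAlong φ τ p z)).sub
      ((hasDerivAt_id t).mul_const ⟪v, h⟫_ℝ)
    refine h2.congr_deriv ?_
    rw [one_mul]; rfl
  · refine Eventually.of_forall fun t => ?_
    have := ((hasDerivAt_id t).pow 2).div_const 2
    simpa using this
  · filter_upwards [self_mem_nhdsWithin] with t ht using (ne_of_gt ht)
  · have h1 : Tendsto (fun t : ℝ => envelopeAlong φ τ p (z + t • h)) (𝓝[>] 0)
        (𝓝 (envelopeAlong φ τ p z)) :=
      (hev.self_of_nhds.continuousAt.tendsto).comp (tendsto_add_smul_nhdsGT z h)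
    have h2 : Tendsto (fun t : ℝ => t * ⟪v, h⟫_ℝ) (𝓝[>] 0) (𝓝 (0 * ⟪v, h⟫_ℝ)) :=
      (tendsto_id.mono_left nhdsWithin_le_nhds).mul_const _
    have h3 := (h1.sub_const (envelopeAlong φ τ p z)).sub h2
    rw [sub_self, zero_mul, sub_zero] at h3
    exact h3
  · have : Continuous fun t : ℝ => t ^ 2 / 2 := by fun_prop
    simpa using (this.tendsto 0).mono_left nhdsWithin_le_nhds
  · have h1 : Tendsto (fun t : ℝ => 1 / τ * (‖h‖ ^ 2 - ⟪t⁻¹ • (p (z + t • h) - p z), h⟫_ℝ))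
        (𝓝[>] 0) (𝓝 (1 / τ * (‖h‖ ^ 2 - ⟪D h, h⟫_ℝ))) :=
      (tendsto_const_nhds.sub ((tendsto_slope_nhdsGT hD h).inner tendsto_const_nhds)).const_mul _
    have h2 : (‖h‖ ^ 2 - ⟪h, D h⟫_ℝ) / τ = 1 / τ * (‖h‖ ^ 2 - ⟪D h, h⟫_ℝ) := by
      rw [real_inner_comm (D h) h]; ring
    rw [h2]
    refine h1.congr' ?_
    filter_upwards [self_mem_nhdsWithin] with t ht
    have ht0 : t ≠ 0 := ne_of_gt ht
    rw [← inner_sub_left, hv, ← smul_sub, real_inner_smul_left (p (z + t • h) - p z),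
      real_inner_smul_left]
    have : z + t • h - p (z + t • h) - (z - p z) = t • h - (p (z + t • h) - p z) := by abel
    rw [this, inner_sub_left (t • h), real_inner_smul_left, real_inner_self_eq_norm_sq]
    field_simp

end Envelope

/-! ### Second subderivatives from derivatives of the proximity operator -/

section SecondOrder

variable {E : Type*} [NormedAddCommGroup E] [InnerProductSpace ℝ E]
  {φ : E → EReal} {τ : ℝ} {p : E → E} {z : E} {D : E →L[ℝ] E}

lemma secondQuotient_of_real {x v w : E} {t r s : ℝ} (hx : φ x = r) (hw : φ (x + t • w) = s) :
    secondQuotient φ x v t w = (((s - r - t * ⟪v, w⟫_ℝ) / (t ^ 2 / 2) : ℝ) : EReal) := by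
  rw [secondQuotient, hx, hw, EReal.coe_div _ (t ^ 2 / 2), EReal.coe_sub, EReal.coe_sub]

lemma sq_norm_residual (hτ : 0 < τ) {x h w : E} {t : ℝ} :
    1 / (2 * τ) * ‖z + t • h - (x + t • w)‖ ^ 2 = 1 / (2 * τ) * ‖z - x‖ ^ 2
      + t * ⟪(1 / τ) • (z - x), h⟫_ℝ - t * ⟪(1 / τ) • (z - x), w⟫_ℝ
      + t ^ 2 / 2 * (‖h - w‖ ^ 2 / τ) := by
  have : z + t • h - (x + t • w) = (z - x) + t • (h - w) := by rw [smul_sub]; abel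
  rw [this, norm_add_sq_real, norm_smul, mul_pow, real_inner_smul_left, real_inner_smul_left,
    real_inner_smul_right, inner_sub_right, Real.norm_eq_abs, sq_abs]
  field_simp
  ring

/-- The second-order difference quotients of the envelope are Moreau envelopes of those of `φ`;
this is the resulting inequality. -/
lemma envelopeQuotient_sub_le (hφ : Proper φ) (hτ : 0 < τ) {h w : E} {t : ℝ} (ht : 0 < t)
    (hz : prox φ τ z = {p z}) (hzt : prox φ τ (z + t • h) = {p (z + t • h)}) :
    ((envelopeQuotient φ τ p z h t - ‖h - w‖ ^ 2 / τ : ℝ) : EReal) ≤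
      secondQuotient φ (p z) ((1 / τ) • (z - p z)) t w := by
  have hx := prox_finite hφ (mem_prox_of_eq hz)
  have ht2 : 0 < t ^ 2 / 2 := by positivity
  rcases eq_or_ne (φ (p z + t • w)) ⊤ with htop | htop
  · rw [secondQuotient, htop, hx, EReal.top_sub_coe, EReal.top_sub_coe,
      EReal.top_div_of_pos_ne_top (EReal.coe_pos.2 ht2) (EReal.coe_ne_top _)]
    exact le_top
  have hs := (EReal.coe_toReal htop (hφ.1 _)).symm
  rw [secondQuotient_of_real hx hs, EReal.coe_le_coe_iff, le_div_iff₀ ht2, sub_mul,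
    envelopeQuotient, div_mul_cancel₀ _ ht2.ne']
  have h1 := envelopeAlong_le hφ hzt hs
  rw [sq_norm_residual hτ] at h1
  rw [envelopeAlong.eq_1 φ τ p z]
  linarith

/-- The inequality `envelopeQuotient_sub_le` is an equality at the difference quotient of `p`. -/
lemma secondQuotient_slope (hφ : Proper φ) (hτ : 0 < τ) {h : E} {t : ℝ} (ht : 0 < t)
    (hz : prox φ τ z = {p z}) (hzt : prox φ τ (z + t • h) = {p (z + t • h)}) :
    secondQuotient φ (p z) ((1 / τ) • (z - p z)) t (t⁻¹ • (p (z + t • h) - p z)) =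
      ((envelopeQuotient φ τ p z h t - ‖h - t⁻¹ • (p (z + t • h) - p z)‖ ^ 2 / τ : ℝ) :
        EReal) := by
  have hx := prox_finite hφ (mem_prox_of_eq hz)
  have hy := prox_finite hφ (mem_prox_of_eq hzt)
  have ht2 : 0 < t ^ 2 / 2 := by positivity
  set w := t⁻¹ • (p (z + t • h) - p z) with hw
  have hpw : p z + t • w = p (z + t • h) := by
    rw [hw, smul_smul, mul_inv_cancel₀ ht.ne', one_smul]; abel
  rw [secondQuotient_of_real hx (hpw ▸ hy), EReal.coe_eq_coe_iff, div_eq_iff ht2.ne', sub_mul,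
    envelopeQuotient, div_mul_cancel₀ _ ht2.ne']
  have h1 := sq_norm_residual hτ (z := z) (x := p z) (h := h) (w := w) (t := t)
  rw [hpw] at h1
  simp only [envelopeAlong]
  rw [hpw]
  linarith

lemma tendsto_secondQuotient_slope (hφ : Proper φ) (hτ : 0 < τ)
    (hs : IsLipschitzProxSelection φ τ p z) (hD : HasFDerivAt p D z) (h : E) :
    Tendsto (fun t => secondQuotient φ (p z) ((1 / τ) • (z - p z)) t
      (t⁻¹ • (p (z + t • h) - p z))) (𝓝[>] 0)
      (𝓝 (((⟪h, D h⟫_ℝ - ‖D h‖ ^ 2) / τ : ℝ) : EReal)) := by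
  have h1 : Tendsto (fun t => envelopeQuotient φ τ p z h t
      - ‖h - t⁻¹ • (p (z + t • h) - p z)‖ ^ 2 / τ) (𝓝[>] 0)
      (𝓝 ((‖h‖ ^ 2 - ⟪h, D h⟫_ℝ) / τ - ‖h - D h‖ ^ 2 / τ)) :=
    (hs.tendsto_envelopeQuotient hφ hτ hD h).sub
      (((tendsto_const_nhds.sub (tendsto_slope_nhdsGT hD h)).norm.pow 2).div_const τ)
  have h2 : (‖h‖ ^ 2 - ⟪h, D h⟫_ℝ) / τ - ‖h - D h‖ ^ 2 / τ = (⟪h, D h⟫_ℝ - ‖D h‖ ^ 2) / τ := by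
    rw [norm_sub_sq_real]; ring
  rw [h2] at h1
  refine (EReal.tendsto_coe.2 h1).congr' ?_
  filter_upwards [self_mem_nhdsWithin, (tendsto_add_smul_nhdsGT z h).eventually hs.prox_eq]
    with t ht hzt
  exact (secondQuotient_slope hφ hτ ht hs.prox_eq.self_of_nhds hzt).symm

/-- Every direction `h` of the envelope gives a lower bound for the second subderivative. -/
lemma le_secondSubderiv (hφ : Proper φ) (hτ : 0 < τ) (hs : IsLipschitzProxSelection φ τ p z)
    (hD : HasFDerivAt p D z) (h w : E) :
    (((‖h‖ ^ 2 - ⟪h, D h⟫_ℝ) / τ - ‖h - w‖ ^ 2 / τ : ℝ) : EReal) ≤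
      secondSubderiv φ (p z) ((1 / τ) • (z - p z)) w := by
  have h1 : Tendsto (fun q : ℝ × E => envelopeQuotient φ τ p z h q.1 - ‖h - q.2‖ ^ 2 / τ)
      (𝓝[>] (0 : ℝ) ×ˢ 𝓝 w) (𝓝 ((‖h‖ ^ 2 - ⟪h, D h⟫_ℝ) / τ - ‖h - w‖ ^ 2 / τ)) :=
    ((hs.tendsto_envelopeQuotient hφ hτ hD h).comp tendsto_fst).sub
      (((tendsto_const_nhds.sub tendsto_snd).norm.pow 2).div_const τ)
  rw [← (EReal.tendsto_coe.2 h1).liminf_eq]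
  refine liminf_le_liminf ?_
  have h2 := (((tendsto_add_smul_nhdsGT z h).eventually hs.prox_eq).and
    (self_mem_nhdsWithin : ∀ᶠ t : ℝ in 𝓝[>] 0, t ∈ Set.Ioi 0)).prod_inl (𝓝 w)
  filter_upwards [h2] with q hq
  exact envelopeQuotient_sub_le hφ hτ hq.2 hs.prox_eq.self_of_nhds hq.1

lemma secondSubderiv_apply (hφ : Proper φ) (hτ : 0 < τ) (hs : IsLipschitzProxSelection φ τ p z)
    (hD : HasFDerivAt p D z) (h : E) :
    secondSubderiv φ (p z) ((1 / τ) • (z - p z)) (D h) =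
      (((⟪h, D h⟫_ℝ - ‖D h‖ ^ 2) / τ : ℝ) : EReal) := by
  refine le_antisymm ?_ ?_
  · have h1 := tendsto_secondQuotient_slope hφ hτ hs hD h
    have h2 : Tendsto (fun t : ℝ => (t, t⁻¹ • (p (z + t • h) - p z))) (𝓝[>] 0)
        (𝓝[>] (0 : ℝ) ×ˢ 𝓝 (D h)) := tendsto_id.prodMk (tendsto_slope_nhdsGT hD h)
    rw [← h1.liminf_eq]
    exact liminf_le_liminf_of_le h2
  · convert le_secondSubderiv hφ hτ hs hD h (D h) using 2
    rw [norm_sub_sq_real]; ring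

/-- Off `range D = (ker D)ᗮ`, the bounds of `le_secondSubderiv` along a ray in `ker D` are
unbounded. -/
lemma secondSubderiv_eq_top [FiniteDimensional ℝ E] (hφ : Proper φ) (hτ : 0 < τ)
    (hs : IsLipschitzProxSelection φ τ p z) (hD : HasFDerivAt p D z) {w : E}
    (hw : w ∉ LinearMap.range (D : E →ₗ[ℝ] E)) :
    secondSubderiv φ (p z) ((1 / τ) • (z - p z)) w = ⊤ := by
  have hsym := hs.isSymmetric hφ hτ hD
  set u := w - rangeProj D w with hu
  have hu0 : u ≠ 0 := fun h => hw (by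
    obtain ⟨g, hg⟩ := exists_eq_rangeProj D w
    exact ⟨g, hg.trans (sub_eq_zero.1 h).symm⟩)
  have hDu : D u = 0 := by rw [hu, map_sub, apply_rangeProj hsym, sub_self]
  have huw : ⟪u, w⟫_ℝ = ‖u‖ ^ 2 := by
    obtain ⟨g, hg⟩ := exists_eq_rangeProj D w
    have h0 : ⟪u, rangeProj D w⟫_ℝ = 0 := by
      have : ⟪D u, g⟫_ℝ = ⟪u, D g⟫_ℝ := hsym u g
      rw [← hg, ← this, hDu, inner_zero_left]
    have h1 : w = u + rangeProj D w := by rw [hu]; abel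
    nth_rewrite 1 [h1]
    rw [inner_add_right, h0, add_zero, real_inner_self_eq_norm_sq]
  have hpos : 0 < ‖u‖ ^ 2 := by positivity
  rw [EReal.eq_top_iff_forall_lt]
  intro y
  -- the bound at `h = s • u` is the affine function `(2 s ‖u‖² - ‖w‖²) / τ` of `s`
  set s := (τ * (y + 1) + ‖w‖ ^ 2) / (2 * ‖u‖ ^ 2) with hsdef
  refine lt_of_lt_of_le ?_ (le_secondSubderiv hφ hτ hs hD (s • u) w)
  rw [EReal.coe_lt_coe_iff, norm_sub_sq_real, map_smul, hDu, smul_zero, inner_zero_right,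
    real_inner_smul_left, huw]
  have h2 : s * (2 * ‖u‖ ^ 2) = τ * (y + 1) + ‖w‖ ^ 2 := by
    rw [hsdef, div_mul_cancel₀ _ (by positivity)]
  have h3 : (‖s • u‖ ^ 2 - 0) / τ - (‖s • u‖ ^ 2 - 2 * (s * ‖u‖ ^ 2) + ‖w‖ ^ 2) / τ
      = (s * (2 * ‖u‖ ^ 2) - ‖w‖ ^ 2) / τ := by ring
  rw [h3, h2, add_sub_cancel_right, mul_div_cancel_left₀ _ hτ.ne']
  linarith

lemma twiceEpiDifferentiable_prox [FiniteDimensional ℝ E] (hφ : Proper φ) (hτ : 0 < τ)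
    (hs : IsLipschitzProxSelection φ τ p z) (hD : HasFDerivAt p D z) :
    TwiceEpiDifferentiable φ (p z) ((1 / τ) • (z - p z)) := by
  intro t ht ht0 w
  have ht' : Tendsto t atTop (𝓝[>] 0) :=
    tendsto_nhdsWithin_iff.2 ⟨ht0, Eventually.of_forall ht⟩
  refine ⟨fun y hy => liminf_le_liminf_of_le (ht'.prodMk hy), ?_⟩
  by_cases hw : w ∈ LinearMap.range (D : E →ₗ[ℝ] E)
  · obtain ⟨h, rfl⟩ := hw
    refine ⟨fun k => (t k)⁻¹ • (p (z + t k • h) - p z), (tendsto_slope_nhdsGT hD h).comp ht', ?_⟩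
    change _ ≤ secondSubderiv φ (p z) ((1 / τ) • (z - p z)) (D h)
    rw [secondSubderiv_apply hφ hτ hs hD]
    exact ((tendsto_secondQuotient_slope hφ hτ hs hD h).comp ht').limsup_eq.le
  · rw [secondSubderiv_eq_top hφ hτ hs hD hw]
    exact ⟨fun _ => w, tendsto_const_nhds, le_top⟩

lemma generalizedQuadratic_prox [FiniteDimensional ℝ E] (hφ : Proper φ) (hτ : 0 < τ)
    (hs : IsLipschitzProxSelection φ τ p z) (hD : HasFDerivAt p D z) :
    GeneralizedQuadratic (secondSubderiv φ (p z) ((1 / τ) • (z - p z))) := by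
  obtain ⟨A, hA, -, -, -, hAD⟩ := exists_symmetric_pseudoinverse (hs.isSymmetric hφ hτ hD) hτ
  refine ⟨LinearMap.range (D : E →ₗ[ℝ] E), A, hA, fun w => ?_⟩
  by_cases hw : w ∈ LinearMap.range (D : E →ₗ[ℝ] E)
  · rw [indicatorFn, if_pos (SetLike.mem_coe.2 hw), add_zero]
    obtain ⟨h, rfl⟩ := hw
    change secondSubderiv φ (p z) ((1 / τ) • (z - p z)) (D h) = ((⟪D h, A (D h)⟫_ℝ : ℝ) : EReal)
    rw [secondSubderiv_apply hφ hτ hs hD, hAD]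
  · rw [indicatorFn, if_neg (fun h => hw (SetLike.mem_coe.1 h)), secondSubderiv_eq_top hφ hτ hs hD hw, EReal.coe_add_top]

end SecondOrder

/-! ### Passage to the limit -/

section Limit

variable {E : Type*} [NormedAddCommGroup E] [InnerProductSpace ℝ E]
  {φ : E → EReal} {τ ρ : ℝ} {xbar vbar : E}

lemma exists_ball_isLipschitzProxSelection (hφ : Proper φ) (hτ : 0 < τ) (hτρ : τ * ρ < 1)
    (hreg : GloballyProxRegular φ xbar vbar ρ) :
    ∃ δ > 0, ∀ z ∈ Metric.ball (xbar + τ • vbar) δ, ∀ p : E → E,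
      (∀ᶠ y in 𝓝 z, prox φ τ y = {p y}) → IsLipschitzProxSelection φ τ p z := by
  obtain ⟨δ, hδ, h⟩ := exists_ball_prox_lipschitz hφ hτ hτρ hreg
  refine ⟨δ, hδ, fun z hz p hp => ⟨hp, (1 - τ * ρ)⁻¹,
    Metric.ball (xbar + τ • vbar) δ ∩ {y | prox φ τ y = {p y}},
    inter_mem (Metric.isOpen_ball.mem_nhds hz) hp, fun y hy y' hy' => ?_⟩⟩
  rw [← div_eq_inv_mul, le_div_iff₀ (by linarith), mul_comm]
  exact h y hy.1 y' hy'.1 _ (mem_prox_of_eq hy.2) _ (mem_prox_of_eq hy'.2)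

lemma tendsto_prox (hφ : Proper φ) (hτ : 0 < τ) (hτρ : τ * ρ < 1)
    (hreg : GloballyProxRegular φ xbar vbar ρ) {z x : ℕ → E}
    (hz : Tendsto z atTop (𝓝 (xbar + τ • vbar))) (hx : ∀ k, x k ∈ prox φ τ (z k)) :
    Tendsto x atTop (𝓝 xbar) := by
  have h0 : Tendsto (fun k => (1 - τ * ρ)⁻¹ * (2 * ‖z k - (xbar + τ • vbar)‖)) atTop (𝓝 0) := by
    simpa using ((tendsto_iff_norm_sub_tendsto_zero.1 hz).const_mul 2).const_mul (1 - τ * ρ)⁻¹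
  rw [tendsto_iff_norm_sub_tendsto_zero]
  refine squeeze_zero (fun _ => norm_nonneg _) (fun k => ?_) h0
  rw [← div_eq_inv_mul, le_div_iff₀ (by linarith), mul_comm]
  exact norm_prox_sub_le hφ hτ hreg (hx k)

/-- A symmetric `D` has the required structure once the quadratic form
`D h ↦ (⟪h, D h⟫ - ‖D h‖²) / τ` on `range D` dominates that of `Q` plus the indicator of `aff S`. -/
lemma hasProxStructure_of_le [FiniteDimensional ℝ E] (hτ : 0 < τ) {Q D : E →L[ℝ] E} {S : Set E}
    (hQ : Q.IsSymmetric) (hD : D.IsSymmetric)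
    (h : ∀ h, ((⟪D h, Q (D h)⟫_ℝ : ℝ) : EReal) + indicatorFn (affineSpan ℝ S : Set E) (D h) ≤
      (((⟪h, D h⟫_ℝ - ‖D h‖ ^ 2) / τ : ℝ) : EReal)) :
    HasProxStructure τ Q S D := by
  obtain ⟨A, hA, hunit, hDA, hrange, hAD⟩ := exists_symmetric_pseudoinverse hD hτ
  have hmem : ∀ g, D g ∈ (affineSpan ℝ S : Set E) := fun g => by
    by_contra hg
    have h1 := h g
    rw [indicatorFn, if_neg hg, EReal.coe_add_top] at h1
    exact absurd h1 (not_le.2 (EReal.coe_lt_top _))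
  have hle : ∀ g, ⟪D g, Q (D g)⟫_ℝ ≤ ⟪D g, A (D g)⟫_ℝ := fun g => by
    have h1 := h g
    rw [indicatorFn, if_pos (hmem g), add_zero, EReal.coe_le_coe_iff] at h1
    rwa [hAD]
  have hAs : ∀ a b, ⟪A a, b⟫_ℝ = ⟪a, A b⟫_ℝ := fun a b => hA a b
  have hQs : ∀ a b, ⟪Q a, b⟫_ℝ = ⟪a, Q b⟫_ℝ := fun a b => hQ a b
  -- `range A ⊆ range D` and the symmetry of `A` give `Π A = A = A Π`
  have hPA : ∀ a, rangeProj D (A a) = A a := fun a => by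
    obtain ⟨g, hg⟩ := hrange ⟨a, rfl⟩
    rw [← hg, rangeProj_apply_self]
  have hAP : ∀ a, A (rangeProj D a) = A a := fun a => by
    refine ext_inner_right ℝ fun w => ?_
    rw [hAs, inner_rangeProj, hPA, hAs]
  refine ⟨A, hA, hunit, hDA, hrange, by rintro _ ⟨g, rfl⟩; exact hmem g, ?_, fun a => ?_⟩
  · intro a b
    change ⟪A a - rangeProj D (Q (rangeProj D a)), b⟫_ℝ
      = ⟪a, A b - rangeProj D (Q (rangeProj D b))⟫_ℝ
    rw [inner_sub_left, inner_sub_right, hAs, inner_rangeProj, hQs, inner_rangeProj]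
  · obtain ⟨g, hg⟩ := exists_eq_rangeProj D a
    change 0 ≤ ⟪A a - rangeProj D (Q (rangeProj D a)), a⟫_ℝ
    have h1 : ⟪A a, a⟫_ℝ = ⟪D g, A (D g)⟫_ℝ := by
      rw [← hAP a, ← hg, ← hPA, inner_rangeProj, ← hg, real_inner_comm, hPA]
    rw [inner_sub_left, h1, inner_rangeProj, ← hg, real_inner_comm (D g) (Q (D g))]
    linarith [hle g]

lemma isSymmetric_of_tendsto {L : ℕ → E →L[ℝ] E} {D : E →L[ℝ] E} (hL : Tendsto L atTop (𝓝 D))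
    (hs : ∀ k, (L k).IsSymmetric) : D.IsSymmetric := by
  have hev : ∀ h, Tendsto (fun k => L k h) atTop (𝓝 (D h)) := fun h =>
    ((ContinuousLinearMap.apply ℝ E h).continuous.tendsto D).comp hL
  intro a b
  refine tendsto_nhds_unique ((hev a).inner (tendsto_const_nhds (x := b))) ?_
  exact ((tendsto_const_nhds (x := a)).inner (hev b)).congr fun k => (hs k a b).symm

theorem hasProxStructure_of_mem_bouligandSubdiff [FiniteDimensional ℝ E] (hφ : Proper φ)
    (hτ : 0 < τ) (hτρ : τ * ρ < 1) (hreg : GloballyProxRegular φ xbar vbar ρ)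
    {Q : E →L[ℝ] E} {S : Set E} (hQ : Q.IsSymmetric)
    (hV : ∀ x v : ℕ → E,
      (∀ k, v k ∈ limitingSubdiff φ (x k)) →
      Tendsto x atTop (𝓝 xbar) → Tendsto v atTop (𝓝 vbar) →
      (∀ k, TwiceEpiDifferentiable φ (x k) (v k)) →
      (∀ k, GeneralizedQuadratic (secondSubderiv φ (x k) (v k))) →
      ∀ w : E,
        ((⟪w, Q w⟫_ℝ : ℝ) : EReal) + indicatorFn (affineSpan ℝ S : Set E) w ≤
          epiLiminf (fun k => secondSubderiv φ (x k) (v k)) w)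
    {D : E →L[ℝ] E} (hD : D ∈ bouligandSubdiff (prox φ τ) (xbar + τ • vbar)) :
    HasProxStructure τ Q S D := by
  obtain ⟨z₀, L₀, hz₀, hL₀, hLD₀⟩ := hD
  obtain ⟨δ, hδ, hsel⟩ := exists_ball_isLipschitzProxSelection hφ hτ hτρ hreg
  obtain ⟨N, hN⟩ := eventually_atTop.1 (hz₀.eventually (Metric.ball_mem_nhds _ hδ))
  choose p₀ hp₀ hdiff₀ using hL₀
  -- discard the finitely many terms outside the ball on which `prox` is Lipschitz
  set z : ℕ → E := fun k => z₀ (k + N)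
  set L : ℕ → E →L[ℝ] E := fun k => L₀ (k + N)
  set p : ℕ → E → E := fun k => p₀ (k + N)
  have hz : Tendsto z atTop (𝓝 (xbar + τ • vbar)) := hz₀.comp (tendsto_add_atTop_nat N)
  have hLD : Tendsto L atTop (𝓝 D) := hLD₀.comp (tendsto_add_atTop_nat N)
  have hs : ∀ k, IsLipschitzProxSelection φ τ (p k) (z k) := fun k =>
    hsel _ (hN _ (Nat.le_add_left N k)) _ (hp₀ _)
  have hdiff : ∀ k, HasFDerivAt (p k) (L k) (z k) := fun k => hdiff₀ _
  have hmem : ∀ k, p k (z k) ∈ prox φ τ (z k) := fun k =>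
    mem_prox_of_eq (hs k).prox_eq.self_of_nhds
  have hx : Tendsto (fun k => p k (z k)) atTop (𝓝 xbar) := tendsto_prox hφ hτ hτρ hreg hz hmem
  have hv : Tendsto (fun k => (1 / τ) • (z k - p k (z k))) atTop (𝓝 vbar) := by
    have h1 := (hz.sub hx).const_smul (1 / τ)
    rwa [add_sub_cancel_left, smul_smul, one_div_mul_cancel hτ.ne', one_smul] at h1
  have hlim := hV _ _ (fun k => prox_mem_limitingSubdiff hφ hτ (hmem k)) hx hv
    (fun k => twiceEpiDifferentiable_prox hφ hτ (hs k) (hdiff k))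
    (fun k => generalizedQuadratic_prox hφ hτ (hs k) (hdiff k))
  refine hasProxStructure_of_le hτ hQ
    (isSymmetric_of_tendsto hLD fun k => (hs k).isSymmetric hφ hτ (hdiff k)) fun h => ?_
  refine (hlim (D h)).trans ?_
  -- test the lower epi-limit along `L k h → D h`
  have hev : Tendsto (fun k => L k h) atTop (𝓝 (D h)) :=
    ((ContinuousLinearMap.apply ℝ E h).continuous.tendsto D).comp hLD
  have h1 : Tendsto (fun k => secondSubderiv φ (p k (z k)) ((1 / τ) • (z k - p k (z k))) (L k h))
      atTop (𝓝 (((⟪h, D h⟫_ℝ - ‖D h‖ ^ 2) / τ : ℝ) : EReal)) := by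
    refine (EReal.tendsto_coe.2 (((tendsto_const_nhds.inner hev).sub
      (hev.norm.pow 2)).div_const τ)).congr fun k => ?_
    exact (secondSubderiv_apply hφ hτ (hs k) (hdiff k) h).symm
  rw [← h1.liminf_eq]
  exact liminf_le_liminf_of_le (tendsto_id.prodMk hev)

end Limit

end VarAnalysis

theorem mainTheorem7 {n : ℕ} (f : Euc n → ℝ) (hf : ContDiff ℝ 2 f)
    (φ : Euc n → EReal) (hφ : Proper φ) (hlsc : LowerSemicontinuous φ)
    (τ : ℝ) (hτ : 0 < τ) (ρ : ℝ) (xbar vbar zbar : Euc n)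
    (hcrit : (0 : Euc n) ∈ limitingSubdiff (fun x => (f x : EReal) + φ x) xbar)
    (hvbar : vbar = -gradient f xbar) (hzbar : zbar = xbar + τ • vbar)
    (hreg : GloballyProxRegular φ xbar vbar ρ) (hτρ : τ * ρ < 1)
    (Q : Euc n →L[ℝ] Euc n) (S : Set (Euc n))
    (hepi : TwiceEpiDifferentiable φ xbar vbar)
    (hquad : GeneralizedConicQuadratic (secondSubderiv φ xbar vbar) Q S)
    (hV : ∀ x v : ℕ → Euc n,
      (∀ k, v k ∈ limitingSubdiff φ (x k)) →
      Tendsto x atTop (𝓝 xbar) → Tendsto v atTop (𝓝 vbar) →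
      (∀ k, TwiceEpiDifferentiable φ (x k) (v k)) →
      (∀ k, GeneralizedQuadratic (secondSubderiv φ (x k) (v k))) →
      ∀ w : Euc n,
        ((⟪w, Q w⟫_ℝ : ℝ) : EReal) + indicatorFn (affineSpan ℝ S : Set (Euc n)) w ≤
          epiLiminf (fun k => secondSubderiv φ (x k) (v k)) w) :
    ∀ D ∈ bouligandSubdiff (prox φ τ) zbar, HasProxStructure τ Q S D := by
  subst hzbar
  exact fun D hD => hasProxStructure_of_mem_bouligandSubdiff hφ hτ hτρ hreg hquad.symm hV hD
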